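/- Let $n,\ell\in\mathbb N$, $0=\tau_0<\tau_1<\dots<\tau_\ell=\Delta$. Let $|\cdot|$ be the infinity norm on $\mathbb R^n$ and on $\mathbb R^{(\ell+1)n}$, let $L^\infty=L^\infty([-\Delta,0],\mathbb R^n)$ with the essential supremum norm $\|\cdot\|$, and let $\mathcal L^\infty$ be the set of Lebesgue measurable, essentially bounded functions $[-\Delta,0]\to\mathbb R^n$. For $\phi\in\mathcal L^\infty$ and $x:J\to\mathbb R^n$, where $J$ is an interval of the form $[t_0,b)$ or $[t_0,b]$ (with $t_0<b<\infty$) or $[t_0,\infty)$, let $\phi\odot_{t_0}x$ be equal to $\phi(t-t_0)$ for $t\in[t_0-\Delta,t_0)$ and to $x(t)$ for $t\in J$; for a function $\mathsf x$ let $\mathsf x_t(s)=\mathsf x(t+s)$, $s\in[-\Delta,0]$, and $\mathsf x(t-\tau_{0:\ell})=(\mathsf x(t-\tau_0),\dots,\mathsf x(t-\tau_\ell))$. A sequence $\phi^k$ in $L^\infty$ converges weakly-* to $\phi^0\in L^\infty$, written $\phi^k\rightharpoonup\phi^0$, if $\int_{-\Delta}^0 g^T\phi^k\to\int_{-\Delta}^0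 g^T\phi^0$ for all $g\in L^1([-\Delta,0],\mathbb R^n)$. Let $f:\mathbb R_{\ge0}\times\mathbb R^{(\ell+1)n}\times L^\infty\to\mathbb R^n$ satisfy: (1) for all $R,T>0$ there are $L\ge0$ and a null set $Z$ with $|f(t,\xi,\phi)-f(t,\zeta,\psi)|\le L\max\{|\xi-\zeta|,\|\phi-\psi\|\}$ for all $t\in[0,T]\setminus Z$ and all $\xi,\zeta,\phi,\psi$ of norm at most $R$; (2) $f(\cdot,0,0)$ is locally essentially bounded; (3) for all $0\le t_0<T$, $\phi\in\mathcal L^\infty$ and continuous $x:[t_0,T]\to\mathbb R^n$, the function $t\mapsto f(t,\mathsf x(t-\tau_{0:\ell}),\mathsf x_t)$, where $\mathsf x=\phi\odot_{t_0}x$, is Lebesgue measurable on $[t_0,T]$; (4) for all $T,R>0$ there is a null set $Z$ such that for every $\varepsilon>0$ and every sequence $\phi^k\rightharpoonup\phi^0$ with $\|\phi^k\|\le R$ there is $j$ with $|f(t,\xi,\phi^k)-f(t,\xi,\phi^0)|<\varepsilon$ for all $t\in[0,T]\setminus Z$, all $|\xi|\le R$ and all $k\ge j$; (5) for all $t_0\ge0$,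 $R\ge0$, continuous $x:[t_0,t_0+\Delta]\to\mathbb R^n$ with $|x|\le R$, every sequence $\phi^k\rightharpoonup\phi^0$ with $\|\phi^k\|\le R$, and every $\varepsilon>0$, there is $j$ such that for all $t\in[t_0,t_0+\Delta]$ and $k\ge j$ the integral $\int_{t_0}^t[f(s,\mathsf x^k(s-\tau_{0:\ell}),\mathsf x^0_s)-f(s,\mathsf x^0(s-\tau_{0:\ell}),\mathsf x^0_s)]\,ds$ exists and has norm $<\varepsilon$, where $\mathsf x^k=\phi^k\odot_{t_0}x$. Consider the system $\dot x(t)=f(t,\mathsf x(t-\tau_{0:\ell}),\mathsf x_t)$, $\mathsf x=\phi\odot_{t_0}x$, $x(t_0)=\xi$, with initial time $t_0\ge0$ and initial condition $(\xi,\phi)\in\mathbb R^n\times L^\infty$; a solution on $J$ is a locally absolutely continuous $x:J\to\mathbb R^n$ with $x(t)=\xi+\int_{t_0}^t f(s,\mathsf x(s-\tau_{0:\ell}),\mathsf x_s)\,ds$ for all $t\in J$ (for any representative of $\phi$), and it is maximal if it has no strict extension that is a solution. For a set $\mathcal P\subseteq\mathbb R^n\times L^\infty$ of initial conditions, the system is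 said to have bounded reachability sets on $\mathcal P$ if for all $t_0\ge0$ and $(\xi,\phi)\in\mathcal P$ the maximal solution $x(\cdot;t_0,\xi,\phi)$ exists and is defined on $[t_0,\infty)$, and $$\sup\{|x(t;t_0,\xi,\phi)|:t\in[t_0,T],\ (\xi,\phi)\in\mathcal P,\ |\xi|\le R,\ \|\phi\|\le R\}<\infty\quad\text{for all }0\le t_0<T,\ R>0.$$ Then the system has bounded reachability sets on $\mathbb R^n\times L^\infty$ if and only if it has bounded reachability sets on the set of continuous initial conditions, i.e. of those $(\xi,\phi)$ for which $\phi$ has a continuous representative $\psi:[-\Delta,0]\to\mathbb R^n$ with $\psi(0)=\xi$. -/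

import Mathlib

open MeasureTheory Set Filter Topology
open scoped ENNReal

noncomputable section

namespace DelaySystem

/-- The state space `ℝⁿ`, with the infinity norm `|x| = max_i |x_i|` (the norm of `Fin n → ℝ`). -/
abbrev E (n : ℕ) : Type := Fin n → ℝ

/-- Lebesgue measure on the interval `[-Δ, 0]`. -/
abbrev delayMeasure (Δ : ℝ) : Measure ℝ := volume.restrict (Icc (-Δ) 0)

/-- `φ ∈ 𝓛^∞([-Δ,0], ℝⁿ)`: `φ` is Lebesgue measurable and essentially bounded on `[-Δ, 0]`
(pointwise defined function; its values outside `[-Δ, 0]` are irrelevant). -/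
def InCalLinf {n : ℕ} (Δ : ℝ) (φ : ℝ → E n) : Prop := MemLp φ ∞ (delayMeasure Δ)

/-- `L^∞([-Δ,0], ℝⁿ)`: equivalence classes, with the essential supremum norm. -/
abbrev Linf (n : ℕ) (Δ : ℝ) : Type := Lp (E n) ∞ (delayMeasure Δ)

open Classical in
/-- The equivalence class in `L^∞` of a function in `𝓛^∞` (and `0` for other functions). -/
def toLinf {n : ℕ} (Δ : ℝ) (φ : ℝ → E n) : Linf n Δ :=
  if h : MemLp φ ∞ (delayMeasure Δ) then h.toLp φ else 0

/-- The concatenation `φ ⊙_{t₀} x`: it is `φ (t - t₀)` for `t < t₀` and `x t` for `t ≥ t₀`. -/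
def conc {n : ℕ} (t₀ : ℝ) (φ x : ℝ → E n) : ℝ → E n :=
  fun t => if t < t₀ then φ (t - t₀) else x t

/-- The history `y_t : [-Δ,0] → ℝⁿ`, `y_t s = y (t + s)`, as an element of `L^∞`. -/
def history {n : ℕ} (Δ : ℝ) (y : ℝ → E n) (t : ℝ) : Linf n Δ :=
  toLinf Δ (fun s => y (t + s))

/-- For `φ ∈ 𝓛^∞` and `x` continuous on `[t₀, t]`, the history of `φ ⊙_{t₀} x` at time `t` is in
`𝓛^∞`, so that `history` is its class and never the default value `0`. -/
theorem memLp_history {n : ℕ} {Δ t₀ t : ℝ} {φ x : ℝ → E n} (hφ : InCalLinf Δ φ)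
    (ht : t₀ ≤ t) (hx : ContinuousOn x (Icc t₀ t)) :
    InCalLinf Δ (fun s => conc t₀ φ x (t + s)) := by
  set c := t - t₀ with hc
  have hA : MeasurableSet {s : ℝ | t + s < t₀} := measurableSet_lt (by fun_prop) measurable_const
  have h1 : MemLp (fun s => φ (s + c)) ∞
      ((delayMeasure Δ).restrict {s : ℝ | t + s < t₀}) := by
    have hmp := (measurePreserving_add_right (volume : Measure ℝ) c).restrict_preimage
      (measurableSet_Icc (a := -Δ) (b := 0))
    refine (hφ.comp_measurePreserving hmp).mono_measure ?_
    rw [Measure.restrict_restrict hA]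
    refine Measure.restrict_mono ?_ le_rfl
    rintro s ⟨hs, hs1, hs2⟩
    simp only [mem_ofPred_eq] at hs
    constructor <;> linarith
  have h2 : MemLp (fun s => x (t + s)) ∞
      ((delayMeasure Δ).restrict {s : ℝ | t + s < t₀}ᶜ) := by
    have hcont : ContinuousOn (fun s => x (t + s)) (Icc (-c) 0) := by
      refine hx.comp (by fun_prop) ?_
      rintro s ⟨hs1, hs2⟩
      constructor <;> linarith
    obtain ⟨C, hC⟩ := isCompact_Icc.exists_bound_of_continuousOn hcont
    have h3 : MemLp (fun s => x (t + s)) ∞ (volume.restrict (Icc (-c) 0)) :=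
      memLp_top_of_bound (hcont.aestronglyMeasurable measurableSet_Icc) C
        ((ae_restrict_iff' measurableSet_Icc).2 (ae_of_all _ hC))
    refine h3.mono_measure ?_
    rw [Measure.restrict_restrict hA.compl]
    refine Measure.restrict_mono ?_ le_rfl
    rintro s ⟨hs, hs1, hs2⟩
    simp only [mem_compl_iff, mem_ofPred_eq, not_lt] at hs
    constructor <;> linarith
  classical
  unfold InCalLinf
  convert MemLp.piecewise hA h1 h2 using 1
  funext s
  by_cases hs : t + s < t₀
  · have : t + s - t₀ = s + c := by rw [hc]; ring
    simp [conc, hs, this]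
  · simp [conc, hs]

/-- Right-hand sides `f : ℝ_{≥0} × ℝ^{(ℓ+1)n} × L^∞ → ℝⁿ`; only the values at times `t ≥ 0` are
ever used. The norm of `Fin (ℓ + 1) → E n` is the infinity norm of `ℝ^{(ℓ+1)n}`. -/
abbrev RHS (n ℓ : ℕ) (Δ : ℝ) : Type := ℝ → (Fin (ℓ + 1) → E n) → Linf n Δ → E n

/-- `f (t, y (t - τ₀), …, y (t - τ_ℓ), y_t)`. -/
def along {n ℓ : ℕ} {Δ : ℝ} (f : RHS n ℓ Δ) (τ : Fin (ℓ + 1) → ℝ) (y : ℝ → E n) (t : ℝ) : E n :=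
  f t (fun i => y (t - τ i)) (history Δ y t)

/-! ### Solutions -/

/-- The intervals `[a, b)` and `[a, b]` with `a < b < ∞`, and `[a, ∞)`. -/
def IsTimeInterval (a : ℝ) (J : Set ℝ) : Prop :=
  (∃ b, a < b ∧ (J = Ico a b ∨ J = Icc a b)) ∨ J = Ici a

/-- `x : J → ℝⁿ` is a solution of `x'(t) = f (t, y (t - τ₀), …, y (t - τ_ℓ), y_t)`,
`y = φ ⊙_{t₀} x`, `x t₀ = φ 0`, for an initial condition `φ ∈ 𝓛^∞` at time `t₀`: it is locally
absolutely continuous and satisfies the integral equation on `J`. Values of `x` outside `J` are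
irrelevant. -/
structure IsSolution {n ℓ : ℕ} {Δ : ℝ} (f : RHS n ℓ Δ) (τ : Fin (ℓ + 1) → ℝ) (t₀ : ℝ)
    (φ : ℝ → E n) (J : Set ℝ) (x : ℝ → E n) : Prop where
  interval : IsTimeInterval t₀ J
  locAbsCont : ∀ t ∈ J, AbsolutelyContinuousOnInterval x t₀ t
  integrable : ∀ t ∈ J, IntervalIntegrable (along f τ (conc t₀ φ x)) volume t₀ t
  integral_eq : ∀ t ∈ J, x t = φ 0 + ∫ s in t₀..t, along f τ (conc t₀ φ x) s

/-- A solution that has no strict extension which is a solution with the same initial data. -/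
def IsMaxSolution {n ℓ : ℕ} {Δ : ℝ} (f : RHS n ℓ Δ) (τ : Fin (ℓ + 1) → ℝ) (t₀ : ℝ)
    (φ : ℝ → E n) (J : Set ℝ) (x : ℝ → E n) : Prop :=
  IsSolution f τ t₀ φ J x ∧
    ∀ (J' : Set ℝ) (y : ℝ → E n), IsSolution f τ t₀ φ J' y → EqOn x y J → ¬ J ⊂ J'

/-- `ψ` is a representative of `φ ∈ L^∞` that takes the value `ξ` at `0`. -/
def Represents {n : ℕ} {Δ : ℝ} (ψ : ℝ → E n) (ξ : E n) (φ : Linf n Δ) : Prop :=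
  ψ =ᵐ[delayMeasure Δ] φ ∧ ψ 0 = ξ

/-- Maximal solutions for an initial condition `(ξ, φ) ∈ ℝⁿ × L^∞` at time `t₀`: the maximal
solutions for a representative `ψ` of `φ` with `ψ 0 = ξ`. The choice of `ψ` is immaterial, because
it changes the integrand of the integral equation on a null set only. -/
def IsMaxSolutionEss {n ℓ : ℕ} {Δ : ℝ} (f : RHS n ℓ Δ) (τ : Fin (ℓ + 1) → ℝ) (t₀ : ℝ)
    (ξ : E n) (φ : Linf n Δ) (J : Set ℝ) (x : ℝ → E n) : Prop :=
  ∃ ψ : ℝ → E n, Represents ψ ξ φ ∧ IsMaxSolution f τ t₀ ψ J x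

/-! ### Assumptions on the right-hand side -/

/-- A family `F` is locally Lipschitz, locally essentially bounded and measurable along
trajectories, with Lipschitz constants and essential bounds that are common to all `f ∈ F`. -/
structure LipschitzFamily {n ℓ : ℕ} {Δ : ℝ} (τ : Fin (ℓ + 1) → ℝ) (F : Set (RHS n ℓ Δ)) :
    Prop where
  lipschitz : ∀ R > 0, ∀ T > 0, ∃ L : ℝ, 0 ≤ L ∧ ∀ f ∈ F, ∃ Z : Set ℝ, volume Z = 0 ∧
    ∀ t ∈ Icc 0 T \ Z, ∀ ξ ζ : Fin (ℓ + 1) → E n, ∀ φ ψ : Linf n Δ,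
      ‖ξ‖ ≤ R → ‖ζ‖ ≤ R → ‖φ‖ ≤ R → ‖ψ‖ ≤ R →
        ‖f t ξ φ - f t ζ ψ‖ ≤ L * max ‖ξ - ζ‖ ‖φ - ψ‖
  bounded : ∀ T > 0, ∃ M : ℝ, ∀ f ∈ F, ∀ᵐ t ∂(volume.restrict (Icc 0 T)), ‖f t 0 0‖ ≤ M
  measurable : ∀ f ∈ F, ∀ t₀ ≥ 0, ∀ T > t₀, ∀ φ x : ℝ → E n,
    InCalLinf Δ φ → ContinuousOn x (Icc t₀ T) →
      AEMeasurable (along f τ (conc t₀ φ x)) (volume.restrict (Icc t₀ T))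

/-- Weak-* convergence of a sequence in `L^∞`, tested against all `g ∈ L^1`. -/
def WeakStarTendsto {n : ℕ} {Δ : ℝ} (φ : ℕ → Linf n Δ) (φ₀ : Linf n Δ) : Prop :=
  ∀ g : ℝ → E n, Integrable g (delayMeasure Δ) →
    Tendsto (fun k => ∫ s, g s ⬝ᵥ φ k s ∂(delayMeasure Δ)) atTop
      (𝓝 (∫ s, g s ⬝ᵥ φ₀ s ∂(delayMeasure Δ)))

/-- `LipschitzFamily`, together with: (`distributed`) weak-* continuity in the distributed
argument, uniform in `f ∈ F`, in `ξ` in balls and in almost every `t` in compact intervals;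
(`discrete`) convergence, uniform in `f ∈ F`, of the integrals in which weakly-* convergent
initial data enter through the discrete delays only. -/
structure WeakStarFamily {n ℓ : ℕ} {Δ : ℝ} (τ : Fin (ℓ + 1) → ℝ) (F : Set (RHS n ℓ Δ)) :
    Prop where
  lipschitzFamily : LipschitzFamily τ F
  distributed : ∀ T > 0, ∀ R > 0, ∃ Z : RHS n ℓ Δ → Set ℝ, (∀ f ∈ F, volume (Z f) = 0) ∧
    ∀ ε > 0, ∀ (φ : ℕ → Linf n Δ) (φ₀ : Linf n Δ), (∀ k, ‖φ k‖ ≤ R) → WeakStarTendsto φ φ₀ →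
      ∃ j : ℕ, ∀ k ≥ j, ∀ f ∈ F, ∀ t ∈ Icc 0 T \ Z f, ∀ ξ : Fin (ℓ + 1) → E n, ‖ξ‖ ≤ R →
        ‖f t ξ (φ k) - f t ξ φ₀‖ < ε
  discrete : ∀ t₀ ≥ 0, ∀ R ≥ 0, ∀ x : ℝ → E n, ContinuousOn x (Icc t₀ (t₀ + Δ)) →
    (∀ t ∈ Icc t₀ (t₀ + Δ), ‖x t‖ ≤ R) →
    ∀ (φ : ℕ → Linf n Δ) (φ₀ : Linf n Δ), (∀ k, ‖φ k‖ ≤ R) → WeakStarTendsto φ φ₀ →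
    ∀ ε > 0, ∃ j : ℕ, ∀ t ∈ Icc t₀ (t₀ + Δ), ∀ k ≥ j, ∀ f ∈ F,
      let y := conc t₀ φ₀ x
      let d := fun s => f s (fun i => conc t₀ (φ k) x (s - τ i)) (history Δ y s)
        - f s (fun i => y (s - τ i)) (history Δ y s)
      IntervalIntegrable d volume t₀ t ∧ ‖∫ s in t₀..t, d s‖ < ε

/-! ### Bounded reachability sets -/

/-- Bounded reachability sets for the initial conditions `(ξ, φ) ∈ ℝⁿ × L^∞` in the class `P`:
from each of them, at each initial time, the maximal solution exists and is defined on `[t₀, ∞)`,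
and the solutions from those with `|ξ| ≤ R`, `‖φ‖ ≤ R` are uniformly bounded on `[t₀, T]`. -/
def HasBRSOn {n ℓ : ℕ} {Δ : ℝ} (f : RHS n ℓ Δ) (τ : Fin (ℓ + 1) → ℝ)
    (P : E n → Linf n Δ → Prop) : Prop :=
  (∀ t₀ ≥ 0, ∀ ξ φ, P ξ φ →
    (∃ J x, IsMaxSolutionEss f τ t₀ ξ φ J x) ∧
    (∀ J x, IsMaxSolutionEss f τ t₀ ξ φ J x → J = Ici t₀)) ∧
  ∀ t₀ ≥ 0, ∀ T > t₀, ∀ R > 0, ∃ M : ℝ, ∀ ξ φ, P ξ φ → ‖ξ‖ ≤ R → ‖φ‖ ≤ R →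
    ∀ J x, IsMaxSolutionEss f τ t₀ ξ φ J x → ∀ t ∈ Icc t₀ T, ‖x t‖ ≤ M

/-- Bounded reachability sets, for all initial conditions in `ℝⁿ × L^∞`. -/
def HasBRS {n ℓ : ℕ} {Δ : ℝ} (f : RHS n ℓ Δ) (τ : Fin (ℓ + 1) → ℝ) : Prop :=
  HasBRSOn f τ (fun _ _ => True)

/-- The initial condition `(ξ, φ)` is continuous: `φ` has a representative that is continuous on
`[-Δ, 0]` and equals `ξ` at `0`. -/
def IsContinuousIC {n : ℕ} {Δ : ℝ} (ξ : E n) (φ : Linf n Δ) : Prop :=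
  ∃ ψ : ℝ → E n, ContinuousOn ψ (Icc (-Δ) 0) ∧ Represents ψ ξ φ

/-- Bounded reachability sets for continuous initial conditions. -/
def HasBRSContinuous {n ℓ : ℕ} {Δ : ℝ} (f : RHS n ℓ Δ) (τ : Fin (ℓ + 1) → ℝ) : Prop :=
  HasBRSOn f τ IsContinuousIC

end DelaySystem

end

namespace DelaySystem

variable {n ℓ : ℕ} {Δ : ℝ}

/-! ### Histories -/

/-! One implication is a restriction to fewer initial conditions. For the other, take `(ξ, φ)` with
both norms at most `R` and choose a representative with value `ξ` at `0`. It is the almost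
everywhere limit of continuous functions that stay in the same ball and equal `ξ` at `0`
(`exists_continuous_seq_tendsto_ae`). These are continuous initial conditions, so their solutions `z
k` are global and bounded on `[t₀, T]` by a constant `M T` that depends only on `t₀`, `R` and `T`.

Along trajectories in a fixed ball the right-hand side is essentially bounded, by a constant
independent of the trajectory. The `z k` are therefore equi-Lipschitz on compact intervals, and a
subsequence converges pointwise on `[t₀, ∞)`. Bounded almost everywhere convergence of the
concatenations implies weak-* convergence of the histories and, at almost every time, convergence of
the delayed values. Hence the right-hand sides converge almost everywhere
(`WeakStarFamily.tendsto_along`), and dominated convergence carries the integral equation to the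
limit.

The limit is thus a global solution that obeys the same bound `M T`
(`HasBRSContinuous.exists_solution`). By uniqueness (`IsSolution.eq_of_mem`), every maximal solution
from `(ξ, φ)` coincides with it, so existence on `[t₀, ∞)` and the uniform bound both pass to `L^∞`
data. -/

theorem coeFn_toLinf {φ : ℝ → E n} (h : InCalLinf Δ φ) : toLinf Δ φ =ᵐ[delayMeasure Δ] φ := by
  have h' : MemLp φ ∞ (delayMeasure Δ) := h
  unfold toLinf
  rw [dif_pos h']
  exact h'.coeFn_toLp

theorem toLinf_congr {φ ψ : ℝ → E n} (h : φ =ᵐ[delayMeasure Δ] ψ) : toLinf Δ φ = toLinf Δ ψ := by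
  unfold toLinf
  by_cases hφ : MemLp φ ∞ (delayMeasure Δ)
  · have hψ := (memLp_congr_ae h).1 hφ
    rw [dif_pos hφ, dif_pos hψ]
    exact (MemLp.toLp_eq_toLp_iff hφ hψ).2 h
  · have hψ := fun h' => hφ ((memLp_congr_ae h).2 h')
    rw [dif_neg hφ, dif_neg hψ]

theorem norm_le_of_ae_norm_le {φ : Linf n Δ} {R : ℝ} (hR : 0 ≤ R)
    (h : ∀ᵐ r ∂delayMeasure Δ, ‖φ r‖ ≤ R) : ‖φ‖ ≤ R := by
  rw [Lp.norm_def]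
  refine ENNReal.toReal_le_of_le_ofReal hR ?_
  rw [eLpNorm_exponent_top]
  exact eLpNormEssSup_le_of_ae_bound h

theorem ae_norm_le_norm (φ : Linf n Δ) : ∀ᵐ r ∂delayMeasure Δ, ‖φ r‖ ≤ ‖φ‖ := by
  filter_upwards [ae_le_eLpNormEssSup (f := φ) (μ := delayMeasure Δ)] with r hr
  rw [Lp.norm_def, eLpNorm_exponent_top, ← toReal_enorm]
  refine ENNReal.toReal_mono ?_ hr
  rw [← eLpNorm_exponent_top]
  exact Lp.eLpNorm_ne_top φ

theorem norm_toLinf_le {φ : ℝ → E n} {R : ℝ} (hR : 0 ≤ R)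
    (h : ∀ᵐ r ∂delayMeasure Δ, ‖φ r‖ ≤ R) : ‖toLinf Δ φ‖ ≤ R := by
  by_cases hφ : MemLp φ ∞ (delayMeasure Δ)
  · refine norm_le_of_ae_norm_le hR ?_
    filter_upwards [h, coeFn_toLinf hφ] with r h1 h2
    rwa [h2]
  -- The default class `0` satisfies any nonnegative bound, so no measurability is needed.
  · unfold toLinf
    rw [dif_neg hφ]
    simpa using hR

theorem norm_toLinf_sub_le {φ ψ : ℝ → E n} {K : ℝ} (hK : 0 ≤ K) (hφ : InCalLinf Δ φ)
    (hψ : InCalLinf Δ ψ) (h : ∀ᵐ r ∂delayMeasure Δ, ‖φ r - ψ r‖ ≤ K) :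
    ‖toLinf Δ φ - toLinf Δ ψ‖ ≤ K := by
  refine norm_le_of_ae_norm_le hK ?_
  filter_upwards [h, coeFn_toLinf hφ, coeFn_toLinf hψ, Lp.coeFn_sub (toLinf Δ φ) (toLinf Δ ψ)]
    with r h1 h2 h3 h4
  rw [h4, Pi.sub_apply, h2, h3]
  exact h1

/-- Bounded almost everywhere convergence implies weak-* convergence. -/
theorem weakStarTendsto_toLinf {φ : ℕ → ℝ → E n} {φ₀ : ℝ → E n} {R : ℝ}
    (hφ : ∀ k, InCalLinf Δ (φ k)) (hφ₀ : InCalLinf Δ φ₀)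
    (hR : ∀ k, ∀ᵐ r ∂delayMeasure Δ, ‖φ k r‖ ≤ R)
    (hlim : ∀ᵐ r ∂delayMeasure Δ, Tendsto (fun k => φ k r) atTop (𝓝 (φ₀ r))) :
    WeakStarTendsto (fun k => toLinf Δ (φ k)) (toLinf Δ φ₀) := by
  intro g hg
  have hdot : ∀ k, AEStronglyMeasurable (fun s => g s ⬝ᵥ toLinf Δ (φ k) s) (delayMeasure Δ) := by
    intro k
    have hc : Continuous (fun p : E n × E n => p.1 ⬝ᵥ p.2) := by
      unfold dotProduct
      fun_prop
    exact hc.comp_aestronglyMeasurable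
      (hg.aestronglyMeasurable.prodMk (Lp.aestronglyMeasurable (toLinf Δ (φ k))))
  -- The dot product has `n` terms, each at most `‖g s‖ * R` in the infinity norm.
  refine tendsto_integral_of_dominated_convergence (fun s => n * (‖g s‖ * R)) hdot
    ((hg.norm.mul_const R).const_mul _) ?_ ?_
  · intro k
    filter_upwards [hR k, coeFn_toLinf (hφ k)] with r h1 h2
    rw [h2]
    unfold dotProduct
    refine (norm_sum_le _ _).trans ?_
    have : ∀ i ∈ (Finset.univ : Finset (Fin n)), ‖g r i * φ k r i‖ ≤ ‖g r‖ * R := by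
      intro i _
      rw [norm_mul]
      exact mul_le_mul (norm_le_pi_norm _ i) ((norm_le_pi_norm _ i).trans h1)
        (norm_nonneg _) (norm_nonneg _)
    refine (Finset.sum_le_card_nsmul _ _ _ this).trans ?_
    simp
  · have h' : ∀ᵐ r ∂delayMeasure Δ, ∀ k, toLinf Δ (φ k) r = φ k r :=
      ae_all_iff.2 fun k => coeFn_toLinf (hφ k)
    filter_upwards [hlim, h', coeFn_toLinf hφ₀] with r h1 h2 h3
    simp only [h2, h3]
    unfold dotProduct
    refine tendsto_finsetSum _ fun i _ => ?_
    exact ((tendsto_pi_nhds.1 h1) i).const_mul _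

/-! ### Almost everywhere properties of concatenations -/

theorem ae_conc {t₀ T : ℝ} {Q : ℝ → Prop} {P : ℝ → Prop}
    (hQ : ∀ᵐ r ∂delayMeasure Δ, Q r)
    (h₁ : ∀ u, u < t₀ → Q (u - t₀) → P u) (h₂ : ∀ u ∈ Icc t₀ T, P u) :
    ∀ᵐ u, u ∈ Icc (t₀ - Δ) T → P u := by
  rw [ae_restrict_iff' measurableSet_Icc] at hQ
  have hq := (measurePreserving_sub_right (volume : Measure ℝ) t₀).quasiMeasurePreserving.ae hQ
  filter_upwards [hq] with u hu hu'
  by_cases h : u < t₀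
  · exact h₁ u h (hu ⟨by linarith [hu'.1], by linarith⟩)
  · exact h₂ u ⟨not_lt.1 h, hu'.2⟩

/-- Translations preserve null sets and there are finitely many delays, so one null set of times
serves all of them. -/
theorem ae_delay {τ : Fin (ℓ + 1) → ℝ} {t₀ T : ℝ} {P : ℝ → Prop} (hτ : ∀ i, τ i ∈ Icc 0 Δ)
    (h : ∀ᵐ u, u ∈ Icc (t₀ - Δ) T → P u) :
    ∀ᵐ s, s ∈ Icc t₀ T → ∀ i, P (s - τ i) := by
  have : ∀ᵐ s, ∀ i, s - τ i ∈ Icc (t₀ - Δ) T → P (s - τ i) :=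
    ae_all_iff.2 fun i =>
      (measurePreserving_sub_right (volume : Measure ℝ) (τ i)).quasiMeasurePreserving.ae h
  filter_upwards [this] with s hs hs' i
  exact hs i ⟨by linarith [hs'.1, (hτ i).2], by linarith [hs'.2, (hτ i).1]⟩

/-- Unlike for the discrete delays, no time `s` is exceptional: the null set lies in the history
variable `r`. -/
theorem ae_history {t₀ T : ℝ} {P : ℝ → Prop} (h : ∀ᵐ u, u ∈ Icc (t₀ - Δ) T → P u)
    {s : ℝ} (hs : s ∈ Icc t₀ T) : ∀ᵐ r ∂delayMeasure Δ, P (s + r) := by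
  rw [ae_restrict_iff' measurableSet_Icc]
  have hq := (measurePreserving_add_left (volume : Measure ℝ) s).quasiMeasurePreserving.ae h
  filter_upwards [hq] with r hr hr'
  exact hr ⟨by linarith [hs.1, hr'.1], by linarith [hs.2, hr'.2]⟩

theorem along_congr {f : RHS n ℓ Δ} {τ : Fin (ℓ + 1) → ℝ} {t₀ T : ℝ} {y y' : ℝ → E n}
    (hτ : ∀ i, τ i ∈ Icc 0 Δ) (h : ∀ᵐ u, u ∈ Icc (t₀ - Δ) T → y u = y' u) :
    ∀ᵐ s, s ∈ Icc t₀ T → along f τ y s = along f τ y' s := by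
  filter_upwards [ae_delay hτ h] with s hs hs'
  have h1 : (fun i => y (s - τ i)) = fun i => y' (s - τ i) := funext (hs hs')
  have h2 : history Δ y s = history Δ y' s := toLinf_congr (ae_history h hs')
  unfold along
  rw [h1, h2]

/-- Comparison with `f s 0 0` through the Lipschitz condition. The exceptional null set of times is
chosen before `ξ` and `φ`, so these may later depend on `s`. -/
theorem LipschitzFamily.exists_bound {τ : Fin (ℓ + 1) → ℝ} {f : RHS n ℓ Δ}
    (hf : LipschitzFamily τ {f}) {R T : ℝ} (hR : 0 < R) (hT : 0 < T) :
    ∃ C : ℝ, 0 ≤ C ∧ ∀ᵐ s, s ∈ Icc 0 T → ∀ ξ φ, ‖ξ‖ ≤ R → ‖φ‖ ≤ R → ‖f s ξ φ‖ ≤ C := by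
  obtain ⟨L, hL, hLip⟩ := hf.lipschitz R hR T hT
  obtain ⟨Z, hZ, hLip⟩ := hLip f rfl
  obtain ⟨M, hM⟩ := hf.bounded T hT
  have hM := hM f rfl
  rw [ae_restrict_iff' measurableSet_Icc] at hM
  refine ⟨max (M + L * R) 0, le_max_right _ _, ?_⟩
  filter_upwards [hM, measure_eq_zero_iff_ae_notMem.1 hZ] with s h1 h2 hs ξ φ hξ hφ
  refine le_trans ?_ (le_max_left _ _)
  have h3 := hLip s ⟨hs, h2⟩ ξ 0 φ 0 hξ (by simpa using hR.le) hφ (by simpa using hR.le)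
  rw [sub_zero, sub_zero] at h3
  have h4 : f s ξ φ = f s 0 0 + (f s ξ φ - f s 0 0) := by abel
  rw [h4]
  refine (norm_add_le _ _).trans (add_le_add (h1 hs) (h3.trans ?_))
  exact mul_le_mul_of_nonneg_left (max_le hξ hφ) hL

theorem ae_norm_conc_le {t₀ T R : ℝ} {ψ x : ℝ → E n} (hψ : ∀ᵐ r ∂delayMeasure Δ, ‖ψ r‖ ≤ R)
    (hx : ∀ t ∈ Icc t₀ T, ‖x t‖ ≤ R) :
    ∀ᵐ u, u ∈ Icc (t₀ - Δ) T → ‖conc t₀ ψ x u‖ ≤ R := by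
  refine ae_conc hψ ?_ ?_
  · intro u hu h
    simpa [conc, hu] using h
  · intro u hu
    simpa [conc, not_lt.2 hu.1] using hx u hu

/-- The constant `C` does not depend on `y`. This gives the approximating solutions a common
Lipschitz constant, and dominated convergence its majorant. -/
theorem LipschitzFamily.exists_along_bound {τ : Fin (ℓ + 1) → ℝ} {f : RHS n ℓ Δ}
    (hτ : ∀ i, τ i ∈ Icc 0 Δ) (hf : LipschitzFamily τ {f}) {R T t₀ : ℝ} (hR : 0 < R)
    (ht₀ : 0 ≤ t₀) (hT : t₀ < T) :
    ∃ C : ℝ, 0 ≤ C ∧ ∀ y : ℝ → E n, (∀ᵐ u, u ∈ Icc (t₀ - Δ) T → ‖y u‖ ≤ R) →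
      ∀ᵐ s, s ∈ Icc t₀ T → ‖along f τ y s‖ ≤ C := by
  obtain ⟨C, hC, h⟩ := hf.exists_bound hR (ht₀.trans_lt hT)
  refine ⟨C, hC, fun y hy => ?_⟩
  filter_upwards [h, ae_delay hτ hy] with s h1 h2 hs
  exact h1 ⟨ht₀.trans hs.1, hs.2⟩ _ _ ((pi_norm_le_iff_of_nonneg hR.le).2 (h2 hs))
    (norm_toLinf_le hR.le (ae_history hy hs))

/-! ### Solutions: dependence on the representative, uniqueness -/

theorem IsTimeInterval.left_le {a t : ℝ} {J : Set ℝ} (hJ : IsTimeInterval a J) (ht : t ∈ J) :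
    a ≤ t := by
  rcases hJ with ⟨b, -, rfl | rfl⟩ | rfl
  exacts [ht.1, ht.1, ht]

theorem IsTimeInterval.Icc_subset {a t : ℝ} {J : Set ℝ} (hJ : IsTimeInterval a J) (ht : t ∈ J) :
    Icc a t ⊆ J := by
  rcases hJ with ⟨b, -, rfl | rfl⟩ | rfl
  exacts [fun s hs => ⟨hs.1, hs.2.trans_lt ht.2⟩, fun s hs => ⟨hs.1, hs.2.trans ht.2⟩,
    fun s hs => hs.1]

theorem IsSolution.continuousOn {f : RHS n ℓ Δ} {τ : Fin (ℓ + 1) → ℝ} {t₀ t : ℝ} {ψ x : ℝ → E n}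
    {J : Set ℝ} (h : IsSolution f τ t₀ ψ J x) (ht : t ∈ J) : ContinuousOn x (Icc t₀ t) := by
  have := (h.locAbsCont t ht).continuousOn
  rwa [uIcc_of_le (h.interval.left_le ht)] at this

theorem ae_conc_congr {t₀ T : ℝ} {ψ ψ' x : ℝ → E n} (h : ψ =ᵐ[delayMeasure Δ] ψ') :
    ∀ᵐ u, u ∈ Icc (t₀ - Δ) T → conc t₀ ψ x u = conc t₀ ψ' x u := by
  refine ae_conc (Q := fun r => ψ r = ψ' r) h ?_ ?_
  · intro u hu h
    simpa [conc, hu] using h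
  · intro u hu
    simp [conc, not_lt.2 hu.1]

theorem IsSolution.congr {f : RHS n ℓ Δ} {τ : Fin (ℓ + 1) → ℝ} {t₀ : ℝ} {ψ ψ' x : ℝ → E n}
    {J : Set ℝ} (hτ : ∀ i, τ i ∈ Icc 0 Δ) (h : IsSolution f τ t₀ ψ J x)
    (hψ : ψ =ᵐ[delayMeasure Δ] ψ') (h0 : ψ 0 = ψ' 0) : IsSolution f τ t₀ ψ' J x := by
  have key : ∀ t ∈ J, ∀ᵐ s, s ∈ uIoc t₀ t →
      along f τ (conc t₀ ψ x) s = along f τ (conc t₀ ψ' x) s := by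
    intro t ht
    filter_upwards [along_congr (f := f) hτ (ae_conc_congr (t₀ := t₀) (T := t) (x := x) hψ)]
      with s hs hs'
    rw [uIoc_of_le (h.interval.left_le ht)] at hs'
    exact hs ⟨hs'.1.le, hs'.2⟩
  refine ⟨h.interval, h.locAbsCont, fun t ht => ?_, fun t ht => ?_⟩
  · refine (h.integrable t ht).congr_ae ?_
    rw [EventuallyEq, ae_restrict_iff' measurableSet_uIoc]
    exact key t ht
  · rw [h.integral_eq t ht, h0, intervalIntegral.integral_congr_ae (key t ht)]

/-- Iterating the integral equation `m` times bounds the difference by `2 * R * (L * (t - t₀)) ^ m /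
m!`, which tends to `0`. The delays do no harm because these bounds increase in `t` and the two
concatenations agree before `t₀`. -/
theorem IsSolution.eq_of_mem {f : RHS n ℓ Δ} {τ : Fin (ℓ + 1) → ℝ} {t₀ b : ℝ}
    {ψ x x' : ℝ → E n} {J J' : Set ℝ} (hτ : ∀ i, τ i ∈ Icc 0 Δ) (hf : LipschitzFamily τ {f})
    (ht₀ : 0 ≤ t₀) (hψ : InCalLinf Δ ψ)
    (h : IsSolution f τ t₀ ψ J x) (h' : IsSolution f τ t₀ ψ J' x') (hb : b ∈ J) (hb' : b ∈ J') :
    x b = x' b := by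
  have htb := h.interval.left_le hb
  have hc := h.continuousOn hb
  have hc' := h'.continuousOn hb'
  obtain ⟨A, hA⟩ := isCompact_Icc.exists_bound_of_continuousOn hc
  obtain ⟨A', hA'⟩ := isCompact_Icc.exists_bound_of_continuousOn hc'
  obtain ⟨B, hB⟩ : ∃ B : ℝ, ∀ᵐ r ∂delayMeasure Δ, ‖ψ r‖ ≤ B := by
    refine ⟨‖toLinf Δ ψ‖, ?_⟩
    filter_upwards [coeFn_toLinf hψ, ae_norm_le_norm (toLinf Δ ψ)] with r h1 h2
    rwa [← h1]
  set R := max (max A A') (max B 1) with hRdef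
  have hR : 0 < R := lt_of_lt_of_le one_pos ((le_max_right _ _).trans (le_max_right _ _))
  have hAR : A ≤ R := (le_max_left _ _).trans (le_max_left _ _)
  have hAR' : A' ≤ R := (le_max_right _ _).trans (le_max_left _ _)
  have hBR : B ≤ R := (le_max_left _ _).trans (le_max_right _ _)
  have hψR : ∀ᵐ r ∂delayMeasure Δ, ‖ψ r‖ ≤ R := hB.mono fun r hr => hr.trans hBR
  have hy := ae_norm_conc_le (t₀ := t₀) hψR fun t ht => (hA t ht).trans hAR
  have hy' := ae_norm_conc_le (t₀ := t₀) hψR fun t ht => (hA' t ht).trans hAR'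
  -- The horizon must be positive, while `b = t₀ = 0` is possible.
  obtain ⟨L, hL, hLip⟩ := hf.lipschitz R hR (b + 1) (by linarith)
  obtain ⟨Z, hZ, hLip⟩ := hLip f rfl
  have hsub := h.interval.Icc_subset hb
  have hsub' := h'.interval.Icc_subset hb'
  have key : ∀ m : ℕ, ∀ t ∈ Icc t₀ b,
      ‖x t - x' t‖ ≤ 2 * R * (L ^ m * (t - t₀) ^ m / m.factorial) := by
    intro m
    induction m with
    | zero =>
      intro t ht
      have := (norm_sub_le (x t) (x' t)).trans
        (add_le_add ((hA t ht).trans hAR) ((hA' t ht).trans hAR'))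
      simp
      linarith
    | succ m ih =>
      intro t ht
      rw [h.integral_eq t (hsub ht), h'.integral_eq t (hsub' ht), add_sub_add_left_eq_sub,
        ← intervalIntegral.integral_sub (h.integrable t (hsub ht)) (h'.integrable t (hsub' ht))]
      have hprim : ∫ s in t₀..t, L * (2 * R * (L ^ m * (s - t₀) ^ m / m.factorial)) =
          2 * R * (L ^ (m + 1) * (t - t₀) ^ (m + 1) / (m + 1).factorial) := by
        have e : (fun s : ℝ => L * (2 * R * (L ^ m * (s - t₀) ^ m / m.factorial))) =
            fun s => (2 * R * L ^ (m + 1) / m.factorial) * (s - t₀) ^ m := by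
          funext s
          ring
        rw [e, intervalIntegral.integral_const_mul,
          intervalIntegral.integral_comp_sub_right (fun s => s ^ m), integral_pow, sub_self,
          zero_pow (Nat.succ_ne_zero m), sub_zero, Nat.factorial_succ]
        push_cast
        have : (m.factorial : ℝ) ≠ 0 := Nat.cast_ne_zero.2 m.factorial_ne_zero
        have : (m : ℝ) + 1 ≠ 0 := by positivity
        field_simp
      rw [← hprim]
      refine intervalIntegral.norm_integral_le_of_norm_le ht.1 ?_ ?_
      · filter_upwards [measure_eq_zero_iff_ae_notMem.1 hZ, ae_delay hτ hy, ae_delay hτ hy']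
          with s h1 h2 h3 hs
        have hsb : s ∈ Icc t₀ b := ⟨hs.1.le, hs.2.trans ht.2⟩
        set K := 2 * R * (L ^ m * (s - t₀) ^ m / m.factorial) with hK
        have hs0 : 0 ≤ s - t₀ := by linarith [hs.1]
        have hK0 : 0 ≤ K := by positivity
        -- The bound at time `s` dominates the difference at every earlier time, so it controls both
        -- the delayed values and the histories.
        have hd : ∀ u ≤ s, ‖conc t₀ ψ x u - conc t₀ ψ x' u‖ ≤ K := by
          intro u hu
          by_cases hut : u < t₀
          · simpa [conc, hut] using hK0
          · have hut' := not_lt.1 hut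
            have h0 : 0 ≤ u - t₀ := by linarith
            simp only [conc, hut, if_false]
            refine (ih u ⟨hut', hu.trans hsb.2⟩).trans ?_
            rw [hK]
            gcongr
        refine (hLip s ⟨⟨ht₀.trans hsb.1, by linarith [hsb.2]⟩, h1⟩ _ _ _ _
          ((pi_norm_le_iff_of_nonneg hR.le).2 (h2 hsb))
          ((pi_norm_le_iff_of_nonneg hR.le).2 (h3 hsb))
          (norm_toLinf_le hR.le (ae_history hy hsb))
          (norm_toLinf_le hR.le (ae_history hy' hsb))).trans ?_
        refine mul_le_mul_of_nonneg_left (max_le ?_ ?_) hL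
        · refine (pi_norm_le_iff_of_nonneg hK0).2 fun i => ?_
          exact hd _ (by linarith [(hτ i).1])
        · refine norm_toLinf_sub_le hK0
            (memLp_history hψ hsb.1 (hc.mono (Icc_subset_Icc_right hsb.2)))
            (memLp_history hψ hsb.1 (hc'.mono (Icc_subset_Icc_right hsb.2))) ?_
          rw [ae_restrict_iff' measurableSet_Icc]
          exact ae_of_all _ fun r hr => hd _ (by linarith [hr.2])
      · exact Continuous.intervalIntegrable (by fun_prop) _ _
  have hlim : Tendsto (fun m : ℕ => 2 * R * (L ^ m * (b - t₀) ^ m / m.factorial)) atTop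
      (𝓝 (2 * R * 0)) := by
    refine Tendsto.const_mul _ ?_
    simp only [← mul_pow]
    exact FloorSemiring.tendsto_pow_div_factorial_atTop _
  rw [mul_zero] at hlim
  have := ge_of_tendsto' hlim fun m => key m b ⟨htb, le_rfl⟩
  exact sub_eq_zero.1 (norm_le_zero_iff.1 this)

/-! ### Approximation by continuous functions, extraction of convergent subsequences -/

/-- Density of continuous functions in `L¹` yields convergence in measure, hence almost everywhere
along a subsequence. Truncation and a cutoff at `0` then restore the bound `R` and the value at `0`
without affecting the limit almost everywhere. -/
theorem exists_continuous_seq_tendsto_ae {μ : Measure ℝ} [IsFiniteMeasure μ] [NullSingletonClass μ]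
    {ψ : ℝ → E n} {R : ℝ} (hm : AEStronglyMeasurable ψ μ) (hψ : ∀ᵐ r ∂μ, ‖ψ r‖ ≤ R)
    (h0 : ‖ψ 0‖ ≤ R) :
    ∃ g : ℕ → ℝ → E n, (∀ k, Continuous (g k)) ∧ (∀ k, g k 0 = ψ 0) ∧ (∀ k r, ‖g k r‖ ≤ R) ∧
      ∀ᵐ r ∂μ, Tendsto (fun k => g k r) atTop (𝓝 (ψ r)) := by
  have hR : 0 ≤ R := (norm_nonneg _).trans h0
  have hint : MemLp ψ 1 μ := (memLp_top_of_bound hm R hψ).mono_exponent le_top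
  have hex : ∀ k : ℕ, ∃ g : ℝ → E n, eLpNorm (ψ - g) 1 μ ≤ ENNReal.ofReal (1 / (k + 1)) ∧
      Continuous g := by
    intro k
    obtain ⟨g, -, h1, h2, -⟩ := hint.exists_hasCompactSupport_eLpNorm_sub_le ENNReal.one_ne_top
      (ε := ENNReal.ofReal (1 / (k + 1))) (by
        have : (0 : ℝ) < 1 / (k + 1) := by positivity
        simpa using this)
    exact ⟨g, h1, h2⟩
  choose g hg hgc using hex
  have hmeas : TendstoInMeasure μ g atTop ψ := by
    refine tendstoInMeasure_of_tendsto_eLpNorm one_ne_zero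
      (fun k => (hgc k).aestronglyMeasurable) hm ?_
    have hz : Tendsto (fun k : ℕ => ENNReal.ofReal (1 / ((k : ℝ) + 1))) atTop (𝓝 0) := by
      rw [← ENNReal.ofReal_zero]
      exact ENNReal.tendsto_ofReal tendsto_one_div_add_atTop_nhds_zero_nat
    refine tendsto_of_tendsto_of_tendsto_of_le_of_le tendsto_const_nhds hz
      (fun _ => zero_le) fun k => ?_
    rw [eLpNorm_sub_comm]
    exact hg k
  obtain ⟨σ, hσ, hlim⟩ := hmeas.exists_seq_tendsto_ae
  -- Componentwise truncation to `[-R, R]`: continuous, and the identity on the closed ball of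
  -- radius `R` in the infinity norm.
  set P : E n → E n := fun v i => max (-R) (min R (v i)) with hP
  have hPc : Continuous P := by fun_prop
  have hPR : ∀ v, ‖P v‖ ≤ R := fun v => by
    refine (pi_norm_le_iff_of_nonneg hR).2 fun i => ?_
    rw [Real.norm_eq_abs, abs_le]
    exact ⟨le_max_left _ _, max_le (by linarith) (min_le_left _ _)⟩
  have hPid : ∀ v, ‖v‖ ≤ R → P v = v := fun v hv => by
    funext i
    have := abs_le.1 ((norm_le_pi_norm v i).trans hv)
    simp [hP, this.1, this.2]
  -- The cutoff vanishes at `0` and is eventually `1` at every other point. A convex combination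
  -- with weight `χ` thus takes the value `ψ 0` at `0` and stays in the ball.
  set χ : ℕ → ℝ → ℝ := fun k r => min 1 (k * |r|) with hχ
  have hχ0 : ∀ k r, 0 ≤ χ k r := fun k r => le_min zero_le_one (by positivity)
  have hχ1 : ∀ k r, χ k r ≤ 1 := fun k r => min_le_left _ _
  refine ⟨fun k r => χ k r • P (g (σ k) r) + (1 - χ k r) • ψ 0, fun k => ?_, fun k => ?_,
    fun k r => ?_, ?_⟩
  · have := hgc (σ k)
    fun_prop
  · simp [hχ]
  · refine (norm_add_le _ _).trans ?_
    rw [norm_smul, norm_smul, Real.norm_of_nonneg (hχ0 k r),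
      Real.norm_of_nonneg (sub_nonneg.2 (hχ1 k r))]
    calc _ ≤ χ k r * R + (1 - χ k r) * R :=
          add_le_add (mul_le_mul_of_nonneg_left (hPR _) (hχ0 k r))
            (mul_le_mul_of_nonneg_left h0 (sub_nonneg.2 (hχ1 k r)))
      _ = R := by ring
  · have hne : ∀ᵐ r ∂μ, r ≠ 0 := by
      rw [ae_iff]
      simp
    filter_upwards [hlim, hψ, hne] with r h1 h2 h3
    have hχlim : Tendsto (fun k => χ k r) atTop (𝓝 1) := by
      refine tendsto_const_nhds.congr' ?_
      filter_upwards [(tendsto_natCast_atTop_atTop (R := ℝ)).eventually_ge_atTop (1 / |r|)]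
        with k hk
      have : 1 ≤ k * |r| := (div_le_iff₀ (abs_pos.2 h3)).1 hk
      simp [hχ, this]
    have hPl := (hPc.tendsto (ψ r)).comp h1
    have := (hχlim.smul hPl).add ((tendsto_const_nhds (x := (1 : ℝ)).sub hχlim).smul
      (tendsto_const_nhds (x := ψ 0)))
    simpa [hPid _ h2] using this

/-- A pointwise bounded, locally equi-Lipschitz sequence on `[a, ∞)` has a pointwise convergent
subsequence. -/
theorem exists_subseq_tendsto_of_lipschitz {z : ℕ → ℝ → E n} {a : ℝ}
    (hb : ∀ t ≥ a, ∃ M, ∀ k, ‖z k t‖ ≤ M)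
    (hL : ∀ T > a, ∃ C, ∀ k, ∀ s ∈ Icc a T, ∀ t ∈ Icc a T, ‖z k t - z k s‖ ≤ C * |t - s|) :
    ∃ σ : ℕ → ℕ, StrictMono σ ∧ ∃ x : ℝ → E n,
      ∀ t ≥ a, Tendsto (fun k => z (σ k) t) atTop (𝓝 (x t)) := by
  have hq : ∀ q : ℚ, a ≤ a + |(q : ℝ)| := fun q => le_add_of_nonneg_right (abs_nonneg _)
  choose M hM using fun q : ℚ => hb (a + |(q : ℝ)|) (hq q)
  -- The times `a + |q|` are countable and dense in `[a, ∞)`. Compactness of the countable product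
  -- replaces the diagonal argument.
  have hcomp : IsCompact (univ.pi fun q : ℚ => Metric.closedBall (0 : E n) (M q)) :=
    isCompact_univ_pi fun q => isCompact_closedBall _ _
  obtain ⟨w, -, σ, hσ, hlim⟩ := hcomp.tendsto_subseq
    (x := fun k (q : ℚ) => z k (a + |(q : ℝ)|)) fun k q _ => by simpa using hM q k
  rw [tendsto_pi_nhds] at hlim
  have hex : ∀ t, ∃ v, t ≥ a → Tendsto (fun k => z (σ k) t) atTop (𝓝 v) := by
    intro t
    by_cases ht : t ≥ a
    swap
    · exact ⟨0, fun h => absurd h ht⟩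
    obtain ⟨C, hC⟩ := hL (t + 1) (by linarith)
    have hcau : CauchySeq fun k => z (σ k) t := by
      refine Metric.cauchySeq_iff.2 fun ε hε => ?_
      -- The `1` keeps the rational time inside `[a, t + 1]`; the other term makes the Lipschitz
      -- error less than `ε / 3`.
      set δ := min 1 (ε / (3 * (|C| + 1))) with hδ
      have hδ0 : 0 < δ := lt_min one_pos (by positivity)
      obtain ⟨q, hq1, hq2⟩ := exists_rat_btwn (show t - a < t - a + δ by linarith)
      have hq0 : |(q : ℝ)| = q := abs_of_pos (by linarith)
      have hqT : a + |(q : ℝ)| ∈ Icc a (t + 1) :=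
        ⟨hq q, by rw [hq0]; linarith [min_le_left 1 (ε / (3 * (|C| + 1)))]⟩
      have hclose : ∀ k, dist (z (σ k) t) (z (σ k) (a + |(q : ℝ)|)) < ε / 3 := by
        intro k
        rw [dist_eq_norm]
        have h1 := hC (σ k) _ hqT t ⟨ht, by linarith⟩
        have h2 : |t - (a + |(q : ℝ)|)| ≤ δ := by
          rw [hq0, abs_le]
          constructor <;> linarith
        calc _ ≤ C * |t - (a + |(q : ℝ)|)| := h1
          _ ≤ |C| * δ := mul_le_mul (le_abs_self C) h2 (abs_nonneg _) (abs_nonneg _)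
          _ < (|C| + 1) * δ := by linarith
          _ ≤ (|C| + 1) * (ε / (3 * (|C| + 1))) := by
              gcongr
              exact min_le_right _ _
          _ = ε / 3 := by
              have : |C| + 1 ≠ 0 := by positivity
              field_simp
      obtain ⟨N, hN⟩ := Metric.cauchySeq_iff.1 (hlim q).cauchySeq (ε / 3) (by positivity)
      refine ⟨N, fun m hm k hk => ?_⟩
      have h1 := hclose m
      have h2 := hclose k
      have h3 := hN m hm k hk
      rw [dist_comm] at h2
      simp only [Function.comp_apply] at h3
      have := dist_triangle4 (z (σ m) t) (z (σ m) (a + |(q : ℝ)|)) (z (σ k) (a + |(q : ℝ)|))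
        (z (σ k) t)
      linarith
    obtain ⟨v, hv⟩ := cauchySeq_tendsto_of_complete hcau
    exact ⟨v, fun _ => hv⟩
  choose x hx using hex
  exact ⟨σ, hσ, x, hx⟩

/-! ### Global solutions as limits -/

/-- If bounded trajectories converge almost everywhere, so do the right-hand sides along them. -/
theorem WeakStarFamily.tendsto_along {τ : Fin (ℓ + 1) → ℝ} {f : RHS n ℓ Δ}
    (hτ : ∀ i, τ i ∈ Icc 0 Δ) (hf : WeakStarFamily τ {f}) {t₀ T R : ℝ} (ht₀ : 0 ≤ t₀)
    (hT : t₀ < T) (hR : 0 < R) {y : ℕ → ℝ → E n} {y₀ : ℝ → E n}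
    (hy : ∀ k, ∀ s ∈ Icc t₀ T, InCalLinf Δ fun r => y k (s + r))
    (hy₀ : ∀ s ∈ Icc t₀ T, InCalLinf Δ fun r => y₀ (s + r))
    (hyR : ∀ k, ∀ᵐ u, u ∈ Icc (t₀ - Δ) T → ‖y k u‖ ≤ R)
    (hlim : ∀ᵐ u, u ∈ Icc (t₀ - Δ) T → Tendsto (fun k => y k u) atTop (𝓝 (y₀ u))) :
    ∀ᵐ s, s ∈ Icc t₀ T → Tendsto (fun k => along f τ (y k) s) atTop (𝓝 (along f τ y₀ s)) := by
  have hT0 : 0 < T := ht₀.trans_lt hT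
  obtain ⟨L, hL, hLip⟩ := hf.lipschitzFamily.lipschitz R hR T hT0
  obtain ⟨Z, hZ, hLip⟩ := hLip f rfl
  obtain ⟨Z', hZ', hdist⟩ := hf.distributed T hT0 R hR
  have hy₀R : ∀ᵐ u, u ∈ Icc (t₀ - Δ) T → ‖y₀ u‖ ≤ R := by
    filter_upwards [hlim, ae_all_iff.2 hyR] with u h1 h2 hu
    exact le_of_tendsto' (h1 hu).norm fun k => h2 k hu
  filter_upwards [measure_eq_zero_iff_ae_notMem.1 hZ, measure_eq_zero_iff_ae_notMem.1 (hZ' f rfl),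
    ae_delay hτ hlim, ae_all_iff.2 fun k => ae_delay hτ (hyR k), ae_delay hτ hy₀R]
    with s h1 h2 h3 h4 h5 hs
  have hs0 : s ∈ Icc 0 T := ⟨ht₀.trans hs.1, hs.2⟩
  set ξ : ℕ → Fin (ℓ + 1) → E n := fun k i => y k (s - τ i) with hξ
  set ξ₀ : Fin (ℓ + 1) → E n := fun i => y₀ (s - τ i) with hξ₀
  have hξR : ∀ k, ‖ξ k‖ ≤ R := fun k => (pi_norm_le_iff_of_nonneg hR.le).2 (h4 k hs)
  have hξ₀R : ‖ξ₀‖ ≤ R := (pi_norm_le_iff_of_nonneg hR.le).2 (h5 hs)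
  have hξlim : Tendsto ξ atTop (𝓝 ξ₀) := tendsto_pi_nhds.2 (h3 hs)
  have hhR : ∀ k, ‖history Δ (y k) s‖ ≤ R := fun k =>
    norm_toLinf_le hR.le (ae_history (hyR k) hs)
  have hweak : WeakStarTendsto (fun k => history Δ (y k) s) (history Δ y₀ s) :=
    weakStarTendsto_toLinf (fun k => hy k s hs) (hy₀ s hs) (fun k => ae_history (hyR k) hs)
      (ae_history hlim hs)
  -- The delayed values are changed while the history stays at index `k`. The Lipschitz estimate
  -- then involves no distance between histories, which need not tend to `0` in norm.
  have hA : Tendsto (fun k => f s (ξ k) (history Δ (y k) s) - f s ξ₀ (history Δ (y k) s))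
      atTop (𝓝 0) := by
    refine squeeze_zero_norm (a := fun k => L * ‖ξ k - ξ₀‖) (fun k => ?_) ?_
    · have := hLip s ⟨hs0, h1⟩ (ξ k) ξ₀ (history Δ (y k) s) (history Δ (y k) s) (hξR k) hξ₀R
        (hhR k) (hhR k)
      rwa [sub_self (history Δ (y k) s), norm_zero, max_eq_left (norm_nonneg _)] at this
    · have := (tendsto_iff_norm_sub_tendsto_zero.1 hξlim).const_mul L
      rwa [mul_zero] at this
  -- With the delayed values frozen at `ξ₀`, only weak-* convergence of the histories is required.
  have hB : Tendsto (fun k => f s ξ₀ (history Δ (y k) s)) atTop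
      (𝓝 (f s ξ₀ (history Δ y₀ s))) := by
    refine Metric.tendsto_atTop.2 fun ε hε => ?_
    obtain ⟨j, hj⟩ := hdist ε hε _ _ hhR hweak
    exact ⟨j, fun k hk => by
      rw [dist_eq_norm]
      exact hj k hk f rfl s ⟨hs0, h2⟩ ξ₀ hξ₀R⟩
  have := hA.add hB
  simpa [along] using this

/-- Compactness argument: the solution is a limit of solutions from continuous data in the same ball
of radius `R`, so the function `M` is inherited unchanged. -/
theorem HasBRSContinuous.exists_solution {τ : Fin (ℓ + 1) → ℝ} {f : RHS n ℓ Δ}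
    (hτ : ∀ i, τ i ∈ Icc 0 Δ) (hf : WeakStarFamily τ {f}) (hc : HasBRSContinuous f τ)
    {t₀ R : ℝ} (ht₀ : 0 ≤ t₀) (hR : 0 < R) {M : ℝ → ℝ}
    (hM : ∀ T > t₀, ∀ ξ φ, IsContinuousIC ξ φ → ‖ξ‖ ≤ R → ‖φ‖ ≤ R →
      ∀ J x, IsMaxSolutionEss f τ t₀ ξ φ J x → ∀ t ∈ Icc t₀ T, ‖x t‖ ≤ M T)
    {ψ : ℝ → E n} (hψ : InCalLinf Δ ψ) (hψR : ∀ᵐ r ∂delayMeasure Δ, ‖ψ r‖ ≤ R)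
    (hψ0 : ‖ψ 0‖ ≤ R) :
    ∃ x, IsSolution f τ t₀ ψ (Ici t₀) x ∧ ∀ T > t₀, ∀ t ∈ Icc t₀ T, ‖x t‖ ≤ M T := by
  obtain ⟨g, hgc, hg0, hgR, hglim⟩ := exists_continuous_seq_tendsto_ae hψ.aestronglyMeasurable
    hψR hψ0
  have hgL : ∀ k, InCalLinf Δ (g k) := fun k =>
    memLp_top_of_bound (hgc k).aestronglyMeasurable R (ae_of_all _ (hgR k))
  have hex : ∀ k, ∃ z, IsSolution f τ t₀ (g k) (Ici t₀) z ∧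
      ∀ T > t₀, ∀ t ∈ Icc t₀ T, ‖z t‖ ≤ M T := by
    intro k
    have hrep : Represents (g k) (g k 0) (toLinf Δ (g k)) := ⟨(coeFn_toLinf (hgL k)).symm, rfl⟩
    have hic : IsContinuousIC (g k 0) (toLinf Δ (g k)) := ⟨g k, (hgc k).continuousOn, hrep⟩
    obtain ⟨⟨J, z, hz⟩, hJ⟩ := hc.1 t₀ ht₀ _ _ hic
    have hbd := fun T hT => hM T hT _ _ hic (hgR k 0)
      (norm_toLinf_le hR.le (ae_of_all _ (hgR k))) J z hz
    obtain rfl := hJ J z hz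
    -- The maximal solution comes with some representative `ψ'`, which is exchanged for `g k`.
    obtain ⟨ψ', hψ', hs, -⟩ := hz
    exact ⟨z, hs.congr hτ (hψ'.1.trans hrep.1.symm) hψ'.2, hbd⟩
  choose z hz hzM using hex
  have hRT : ∀ T, ∃ R', 0 < R' ∧ R ≤ R' ∧ M T ≤ R' := fun T =>
    ⟨max R (M T), lt_max_of_lt_left hR, le_max_left _ _, le_max_right _ _⟩
  have hCex : ∀ T > t₀, ∃ C, 0 ≤ C ∧ ∀ k, ∀ᵐ s, s ∈ Icc t₀ T →
      ‖along f τ (conc t₀ (g k) (z k)) s‖ ≤ C := by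
    intro T hT
    obtain ⟨R', hR', h1, h2⟩ := hRT T
    obtain ⟨C, hC0, hC⟩ := hf.lipschitzFamily.exists_along_bound hτ hR' ht₀ hT
    exact ⟨C, hC0, fun k => hC _ (ae_norm_conc_le (ae_of_all _ fun r => (hgR k r).trans h1)
      fun t ht => (hzM k T hT t ht).trans h2)⟩
  have hzLip : ∀ T > t₀, ∃ C, 0 ≤ C ∧ ∀ k, ∀ s ∈ Icc t₀ T, ∀ t ∈ Icc t₀ T,
      ‖z k t - z k s‖ ≤ C * |t - s| := by
    intro T hT
    obtain ⟨C, hC0, hC⟩ := hCex T hT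
    refine ⟨C, hC0, fun k s hs t ht => ?_⟩
    rw [(hz k).integral_eq t ht.1, (hz k).integral_eq s hs.1, add_sub_add_left_eq_sub,
      intervalIntegral.integral_interval_sub_left ((hz k).integrable t ht.1)
        ((hz k).integrable s hs.1)]
    refine intervalIntegral.norm_integral_le_of_norm_le_const_ae ?_
    filter_upwards [hC k] with u hu hu'
    exact hu ((uIcc_subset_Icc hs ht) (uIoc_subset_uIcc hu'))
  obtain ⟨σ, hσ, x, hx⟩ := exists_subseq_tendsto_of_lipschitz (z := z) (a := t₀)
    (fun t ht => ⟨M (t + 1), fun k => hzM k (t + 1) (by linarith) t ⟨ht, by linarith⟩⟩)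
    (fun T hT => (hzLip T hT).imp fun C hC => hC.2)
  have hxM : ∀ T > t₀, ∀ t ∈ Icc t₀ T, ‖x t‖ ≤ M T := fun T hT t ht =>
    le_of_tendsto' (hx t ht.1).norm fun k => hzM _ T hT t ht
  have hxLip : ∀ T > t₀, ∃ K, LipschitzOnWith K x (Icc t₀ T) := by
    intro T hT
    obtain ⟨C, hC0, hC⟩ := hzLip T hT
    refine ⟨C.toNNReal, LipschitzOnWith.of_dist_le_mul fun t ht s hs => ?_⟩
    rw [Real.coe_toNNReal C hC0, dist_eq_norm, Real.dist_eq]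
    exact le_of_tendsto' ((hx t ht.1).sub (hx s hs.1)).norm fun k => hC _ s hs t ht
  have hxc : ∀ T > t₀, ContinuousOn x (Icc t₀ T) := fun T hT =>
    (hxLip T hT).choose_spec.continuousOn
  have hlim : ∀ T > t₀, ∀ᵐ s, s ∈ Icc t₀ T →
      Tendsto (fun k => along f τ (conc t₀ (g (σ k)) (z (σ k))) s) atTop
        (𝓝 (along f τ (conc t₀ ψ x) s)) := by
    intro T hT
    obtain ⟨R', hR', h1, h2⟩ := hRT T
    refine hf.tendsto_along hτ ht₀ hT hR' ?_ ?_ ?_ ?_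
    · exact fun k s hs => memLp_history (hgL _) hs.1 ((hz _).continuousOn hs.1)
    · exact fun s hs => memLp_history hψ hs.1 ((hxc T hT).mono (Icc_subset_Icc_right hs.2))
    · exact fun k => ae_norm_conc_le (ae_of_all _ fun r => (hgR _ r).trans h1)
        fun t ht => (hzM _ T hT t ht).trans h2
    · refine ae_conc hglim ?_ ?_
      · intro u hu h
        simpa [conc, hu, Function.comp_def] using h.comp hσ.tendsto_atTop
      · intro u hu
        simpa [conc, not_lt.2 hu.1] using hx u hu.1
  have hyint : ∀ t ≥ t₀, IntervalIntegrable (along f τ (conc t₀ ψ x)) volume t₀ t := by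
    intro t ht
    have hT : t₀ < t + 1 := by linarith
    obtain ⟨C, hC0, hC⟩ := hCex (t + 1) hT
    -- Integrability along the limit: measurability is the assumption on trajectories, and the bound
    -- `C` passes to the almost everywhere limit.
    have hmeas := hf.lipschitzFamily.measurable f rfl t₀ ht₀ (t + 1) hT ψ x hψ (hxc _ hT)
    have : IntegrableOn (along f τ (conc t₀ ψ x)) (Icc t₀ (t + 1)) := by
      refine Integrable.of_bound hmeas.aestronglyMeasurable C ?_
      rw [ae_restrict_iff' measurableSet_Icc]
      filter_upwards [hlim _ hT, ae_all_iff.2 hC] with s h1 h2 hs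
      exact le_of_tendsto' (h1 hs).norm fun k => h2 _ hs
    rw [intervalIntegrable_iff_integrableOn_Icc_of_le ht]
    exact this.mono_set (Icc_subset_Icc_right (by linarith))
  refine ⟨x, ⟨Or.inr rfl, fun t ht => ?_, hyint, fun t ht => ?_⟩, hxM⟩
  · have ht' : t₀ ≤ t := ht
    obtain ⟨K, hK⟩ := hxLip (t + 1) (by linarith)
    refine LipschitzOnWith.absolutelyContinuousOnInterval (K := K) ?_
    rw [uIcc_of_le ht']
    exact hK.mono (Icc_subset_Icc_right (by linarith))
  · have ht' : t₀ ≤ t := ht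
    have hT : t₀ < t + 1 := by linarith
    obtain ⟨C, hC0, hC⟩ := hCex (t + 1) hT
    have hsub : ∀ s ∈ uIoc t₀ t, s ∈ Icc t₀ (t + 1) := by
      intro s hs
      rw [uIoc_of_le ht'] at hs
      exact ⟨hs.1.le, by linarith [hs.2]⟩
    have hint : Tendsto (fun k => ∫ s in t₀..t, along f τ (conc t₀ (g (σ k)) (z (σ k))) s) atTop
        (𝓝 (∫ s in t₀..t, along f τ (conc t₀ ψ x) s)) := by
      refine intervalIntegral.tendsto_integral_filter_of_dominated_convergence (fun _ => C)
        (Eventually.of_forall fun k => ?_) (Eventually.of_forall fun k => ?_)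
        intervalIntegrable_const ?_
      · exact (intervalIntegrable_iff.1 ((hz (σ k)).integrable t ht)).aestronglyMeasurable
      · filter_upwards [hC (σ k)] with s h1 hs
        exact h1 (hsub s hs)
      · filter_upwards [hlim _ hT] with s h1 hs
        exact h1 (hsub s hs)
    -- Both sides are limits of `z (σ k) t`; the initial value is exactly `ψ 0` for every `k`.
    refine tendsto_nhds_unique (hx t ht') ?_
    have h2 := hint.const_add (ψ 0)
    refine h2.congr fun k => ?_
    rw [(hz (σ k)).integral_eq t ht, hg0]

/-! ### Maximal solutions and the equivalence -/

theorem IsSolution.isMaxSolution {τ : Fin (ℓ + 1) → ℝ} {f : RHS n ℓ Δ} {t₀ : ℝ}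
    {ψ x : ℝ → E n} (h : IsSolution f τ t₀ ψ (Ici t₀) x) :
    IsMaxSolution f τ t₀ ψ (Ici t₀) x :=
  ⟨h, fun _ _ hy _ hlt => hlt.2 fun _ ht => hy.interval.left_le ht⟩

/-- If there is a solution on `[t₀, ∞)`, then it is the only maximal solution. -/
theorem IsSolution.eq_of_isMaxSolutionEss {τ : Fin (ℓ + 1) → ℝ} {f : RHS n ℓ Δ}
    {t₀ : ℝ} {φ : Linf n Δ} {x x' : ℝ → E n} {J : Set ℝ} {ξ : E n} {ψ : ℝ → E n}
    (hτ : ∀ i, τ i ∈ Icc 0 Δ) (hf : LipschitzFamily τ {f}) (ht₀ : 0 ≤ t₀)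
    (hψ : Represents ψ ξ φ) (h : IsSolution f τ t₀ ψ (Ici t₀) x)
    (h' : IsMaxSolutionEss f τ t₀ ξ φ J x') : J = Ici t₀ ∧ EqOn x x' J := by
  obtain ⟨ψ', hψ', hs, hmax⟩ := h'
  have hL' : InCalLinf Δ ψ' := (memLp_congr_ae hψ'.1).2 (Lp.memLp φ)
  have h1 : IsSolution f τ t₀ ψ' (Ici t₀) x :=
    h.congr hτ (hψ.1.trans hψ'.1.symm) (hψ.2.trans hψ'.2.symm)
  have hJ : J ⊆ Ici t₀ := fun t ht => hs.interval.left_le ht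
  have heq : EqOn x x' J := fun t ht => h1.eq_of_mem hτ hf ht₀ hL' hs (hJ ht) ht
  refine ⟨?_, heq⟩
  by_contra hne
  -- Otherwise the global solution would strictly extend the maximal one.
  exact hmax _ x h1 heq.symm (hJ.ssubset_of_ne hne)

theorem HasBRSContinuous.hasBRS {τ : Fin (ℓ + 1) → ℝ} {f : RHS n ℓ Δ}
    (hτ : ∀ i, τ i ∈ Icc 0 Δ) (hf : WeakStarFamily τ {f}) (hc : HasBRSContinuous f τ) :
    HasBRS f τ := by
  -- The bound `M` is fixed before `(ξ, φ)`, which makes it uniform over the ball of radius `R`.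
  have main : ∀ t₀ ≥ 0, ∀ R > 0, ∃ M : ℝ → ℝ, ∀ (ξ : E n) (φ : Linf n Δ), ‖ξ‖ ≤ R → ‖φ‖ ≤ R →
      ∃ ψ x, Represents ψ ξ φ ∧ IsSolution f τ t₀ ψ (Ici t₀) x ∧
        ∀ T > t₀, ∀ t ∈ Icc t₀ T, ‖x t‖ ≤ M T := by
    intro t₀ ht₀ R hR
    have hex : ∀ T, ∃ M : ℝ, T > t₀ → ∀ ξ φ, IsContinuousIC ξ φ → ‖ξ‖ ≤ R → ‖φ‖ ≤ R →
        ∀ J x, IsMaxSolutionEss f τ t₀ ξ φ J x → ∀ t ∈ Icc t₀ T, ‖x t‖ ≤ M := by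
      intro T
      by_cases hT : T > t₀
      · exact (hc.2 t₀ ht₀ T hT R hR).imp fun M hM _ => hM
      · exact ⟨0, fun h => absurd h hT⟩
    choose M hM using hex
    refine ⟨M, fun ξ φ hξ hφ => ?_⟩
    -- A class in `L^∞` does not determine a value at `0`; since `{0}` is null, `ξ` can be
    -- prescribed there.
    have hae : (Function.update φ 0 ξ : ℝ → E n) =ᵐ[delayMeasure Δ] φ := by
      have hne : ∀ᵐ r ∂delayMeasure Δ, r ≠ 0 := by
        rw [ae_iff]
        simp
      filter_upwards [hne] with r hr
      exact Function.update_of_ne hr _ _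
    have hrep : Represents (Function.update φ 0 ξ) ξ φ := ⟨hae, Function.update_self ..⟩
    obtain ⟨x, hx, hxM⟩ := hc.exists_solution hτ hf ht₀ hR hM
      (ψ := Function.update φ 0 ξ) ((memLp_congr_ae hae).2 (Lp.memLp φ))
      (by
        filter_upwards [hae, ae_norm_le_norm φ] with r h1 h2
        rw [h1]
        exact h2.trans hφ)
      (by rwa [hrep.2])
    exact ⟨_, x, hrep, hx, hxM⟩
  have hfL := hf.lipschitzFamily
  refine ⟨fun t₀ ht₀ ξ φ _ => ?_, fun t₀ ht₀ T hT R hR => ?_⟩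
  · obtain ⟨M, hM⟩ := main t₀ ht₀ (max (max ‖ξ‖ ‖φ‖) 1) (lt_max_of_lt_right one_pos)
    obtain ⟨ψ, x, hψ, hx, -⟩ := hM ξ φ ((le_max_left _ _).trans (le_max_left _ _))
      ((le_max_right _ _).trans (le_max_left _ _))
    exact ⟨⟨_, x, ψ, hψ, hx.isMaxSolution⟩,
      fun J x' h' => (hx.eq_of_isMaxSolutionEss hτ hfL ht₀ hψ h').1⟩
  · obtain ⟨M, hM⟩ := main t₀ ht₀ R hR
    refine ⟨M T, fun ξ φ _ hξ hφ J x' h' t ht => ?_⟩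
    obtain ⟨ψ, x, hψ, hx, hxM⟩ := hM ξ φ hξ hφ
    obtain ⟨rfl, heq⟩ := hx.eq_of_isMaxSolutionEss hτ hfL ht₀ hψ h'
    rw [← heq ht.1]
    exact hxM T hT t ht

theorem HasBRS.hasBRSContinuous {τ : Fin (ℓ + 1) → ℝ} {f : RHS n ℓ Δ}
    (h : HasBRS f τ) : HasBRSContinuous f τ :=
  ⟨fun t₀ ht₀ ξ φ _ => h.1 t₀ ht₀ ξ φ trivial, fun t₀ ht₀ T hT R hR =>
    (h.2 t₀ ht₀ T hT R hR).imp fun _ hM ξ φ _ => hM ξ φ trivial⟩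

end DelaySystem

theorem proposition7 (n ℓ : ℕ) (hℓ : 1 ≤ ℓ) (Δ : ℝ) (τ : Fin (ℓ + 1) → ℝ)
    (hτ₀ : τ 0 = 0) (hτ : StrictMono τ) (hΔ : τ (Fin.last ℓ) = Δ)
    (f : DelaySystem.RHS n ℓ Δ) (hf : DelaySystem.WeakStarFamily τ {f}) :
    DelaySystem.HasBRS f τ ↔ DelaySystem.HasBRSContinuous f τ := by
  have hτ' : ∀ i, τ i ∈ Set.Icc 0 Δ := fun i =>
    ⟨hτ₀ ▸ hτ.monotone (Fin.zero_le i), hΔ ▸ hτ.monotone (Fin.le_last i)⟩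
  exact ⟨fun h => h.hasBRSContinuous, fun h => h.hasBRS hτ' hf⟩
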